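/- Let $\mathbf X=(X_1,X_2,\dots)$ be a stationary ergodic process with values in a finite alphabet $\mathcal X$ that is Markov of some finite order $\ell\ge 0$, i.e. the conditional law of each $X_i$, $i>\ell$, given $X_1,\dots,X_{i-1}$ depends only on $X_{i-\ell},\dots,X_{i-1}$. Let $k_1=k_1(n)$ be nonnegative integers with $k_1(n)=o(\log n)$ as $n\to\infty$. For $a^{k_1}\in\mathcal X^{k_1}$ put $$\hat p^{(k_1)}(a^{k_1})=\frac1n\,\bigl|\{1\le i\le n:(X_{i-k_1},\dots,X_{i-1})=a^{k_1}\}\bigr|,$$ where indices are read cyclically modulo $n$ (so that $X_{i}:=X_{n+i}$ for $i\le 0$), and let $p^{(k_1)}(a^{k_1})=P\bigl((X_1,\dots,X_{k_1})=a^{k_1}\bigr)$. Then, almost surely, $$\bigl\|\hat p^{(k_1(n))}-p^{(k_1(n))}\bigr\|_{\rm TV}=\frac12\sum_{a\in\mathcal X^{k_1(n)}}\bigl|\hat p^{(k_1(n))}(a)-p^{(k_1(n))}(a)\bigr|\longrightarrow 0\qquad(n\to\infty).$$ -/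

import Mathlib

open Filter Topology MeasureTheory ProbabilityTheory Asymptotics

/-- The (one-sided) shift on sequences. -/
def seqShift {α : Type*} (x : ℕ → α) : ℕ → α := fun i => x (i + 1)

/-- The process `X = (X 0, X 1, …)` is stationary and ergodic: the shift preserves the law of `X`
on sequence space (stationarity) and every shift-invariant event is trivial (ergodicity). -/
def IsStationaryErgodic {Ω α : Type*} [MeasurableSpace Ω] [MeasurableSpace α]
    (μ : Measure Ω) (X : ℕ → Ω → α) : Prop :=
  Ergodic seqShift (μ.map (fun ω i => X i ω))

/-- The discrete process `X` is Markov of order `l`: given a past of positive probability, the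
conditional law of the next symbol depends only on the last `l` symbols of that past. -/
def IsMarkovOfOrder {Ω α : Type*} [MeasurableSpace Ω]
    (μ : Measure Ω) (X : ℕ → Ω → α) (l : ℕ) : Prop :=
  ∀ (m : ℕ) (x : ℕ → α), μ {ω | ∀ i < m + l, X i ω = x i} ≠ 0 →
    μ[{ω | X (m + l) ω = x (m + l)} | {ω | ∀ i < m + l, X i ω = x i}] =
      μ[{ω | X (m + l) ω = x (m + l)} | {ω | ∀ i, m ≤ i → i < m + l → X i ω = x i}]

/-- The `k`-th order empirical distribution of the word `x 0, …, x (n - 1)`: the fraction, among its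
`n` cyclic windows of length `k` (positions are read modulo `n`), of those that equal `a`. -/
noncomputable def empiricalDist {α : Type*} [DecidableEq α]
    (n k : ℕ) (x : ℕ → α) (a : Fin k → α) : ℝ :=
  (((Finset.range n).filter
    (fun j => (fun t : Fin k => x ((j + (t : ℕ)) % n)) = a)).card : ℝ) / (n : ℝ)

/-- The `k`-th order distribution of the process: the probability that `(X 0, …, X (k - 1)) = a`. -/
noncomputable def blockDist {Ω α : Type*} [MeasurableSpace Ω]
    (μ : Measure Ω) (X : ℕ → Ω → α) (k : ℕ) (a : Fin k → α) : ℝ :=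
  μ.real {ω | (fun t : Fin k => X (t : ℕ) ω) = a}

/-- The total variation distance of two distributions on a finite set. -/
noncomputable def tvDistance {β : Type*} [Fintype β] (p q : β → ℝ) : ℝ :=
  (1 / 2) * ∑ b, |p b - q b|

/-!
Lengthening a word by one symbol costs little. Let `p̂ₖ` be the frequencies of words of length `k` and
`pₖ` their probabilities, and let `T a = pₖ₊₁ a / pₖ (init a)`. For a word `a` of length `k + 1`,

  `p̂ₖ₊₁ a - pₖ₊₁ a = T a * (p̂ₖ (init a) - pₖ (init a)) + (1 / n) * ∑ j < n, excess a j`,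

where `excess a j` is the indicator that `a` occurs at position `j`, minus `T a` times the indicator
that `init a` does. Since `∑ c, T (snoc b c) ≤ 1`, summing over `a` shows that `‖p̂ₖ₊₁ - pₖ₊₁‖₁` exceeds
`‖p̂ₖ - pₖ‖₁` by at most `(1 / n) * ∑ a, |∑ j < n, excess a j|` (`sum_abs_blockFreq_sub_succ_le`). No
mixing rate of the process is needed.

When `k` is at least the Markov order, `excess a j` is orthogonal to every function of the symbols
before position `j + k` (`integral_mul_excess`), so `∑ j < n, excess a j` is a martingale with increments
bounded by `1`, and an Azuma bound gives
`P (|∑ j < n, excess a j| ≥ n ^ (3 / 4)) ≤ 2 * exp (1 - n ^ (1 / 4))`. Because `k n = o(log n)`, at most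
`n ^ (1 / 8)` words matter for large `n`. By Borel–Cantelli the total cost of passing from the Markov
order `l` to length `k n` is therefore almost surely at most `n ^ (1 / 8 + 3 / 4 - 1)` eventually
(`ae_eventually_abs_sum_excess_lt`).

For the finitely many lengths `k ≤ l`, convergence is the pointwise ergodic theorem applied to
cylinders; it is proved here for bounded functions (`Ergodic.ae_tendsto_birkhoffSum_div`). The argument
uses windows that run beyond position `n` instead of wrapping around, which changes the frequencies by
at most `2 * k / n` in total (`sum_abs_empiricalDist_sub_blockFreq_le`).
-/

/-! ### A pointwise ergodic theorem for bounded functions -/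

/-- The running maximum `max (0, S₁, …, Sₙ)` of the Birkhoff sums of `f` along `T`, in the recursive
form `Mₙ₊₁ = max 0 (f + Mₙ ∘ T)`. -/
def birkhoffMax {E : Type*} (T : E → E) (f : E → ℝ) : ℕ → E → ℝ
  | 0 => fun _ => 0
  | n + 1 => fun x => max 0 (f x + birkhoffMax T f n (T x))

lemma birkhoffMax_nonneg {E : Type*} (T : E → E) (f : E → ℝ) (n : ℕ) (x : E) :
    0 ≤ birkhoffMax T f n x := by
  cases n with
  | zero => exact le_rfl
  | succ n => exact le_max_left _ _

lemma birkhoffMax_le_succ {E : Type*} (T : E → E) (f : E → ℝ) (n : ℕ) (x : E) :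
    birkhoffMax T f n x ≤ birkhoffMax T f (n + 1) x := by
  induction n generalizing x with
  | zero => exact birkhoffMax_nonneg T f 1 x
  | succ n ih =>
    change max 0 (f x + birkhoffMax T f n (T x)) ≤ max 0 (f x + birkhoffMax T f (n + 1) (T x))
    gcongr
    exact ih (T x)

lemma birkhoffSum_le_birkhoffMax {E : Type*} (T : E → E) (f : E → ℝ) (n : ℕ) (x : E) :
    birkhoffSum T f n x ≤ birkhoffMax T f n x := by
  induction n generalizing x with
  | zero => simp [birkhoffMax]
  | succ n ih =>
    rw [birkhoffSum_succ']
    exact le_max_of_le_right (by gcongr; exact ih (T x))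

lemma birkhoffMax_le_mul {E : Type*} (T : E → E) {f : E → ℝ} {C : ℝ} (hC : ∀ x, |f x| ≤ C) (n : ℕ)
    (x : E) : birkhoffMax T f n x ≤ n * C := by
  have hC0 : 0 ≤ C := (abs_nonneg _).trans (hC x)
  induction n generalizing x with
  | zero => simp [birkhoffMax]
  | succ n ih =>
    refine max_le (by positivity) ?_
    have h1 := (abs_le.1 (hC x)).2
    have h2 := ih (T x)
    push_cast
    linarith

lemma measurable_birkhoffMax {E : Type*} [MeasurableSpace E] {T : E → E} {f : E → ℝ}
    (hT : Measurable T) (hf : Measurable f) (n : ℕ) : Measurable (birkhoffMax T f n) := by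
  induction n with
  | zero => exact measurable_const
  | succ n ih => exact measurable_const.max (hf.add (ih.comp hT))

lemma integrable_birkhoffMax {E : Type*} [MeasurableSpace E] {P : Measure E} [IsFiniteMeasure P]
    {T : E → E} {f : E → ℝ} {C : ℝ} (hT : Measurable T) (hf : Measurable f)
    (hC : ∀ x, |f x| ≤ C) (n : ℕ) : Integrable (birkhoffMax T f n) P := by
  refine Integrable.of_bound (measurable_birkhoffMax hT hf n).aestronglyMeasurable (n * C)
    (ae_of_all _ fun x => ?_)
  rw [Real.norm_of_nonneg (birkhoffMax_nonneg T f n x)]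
  exact birkhoffMax_le_mul T hC n x

/-- Under an ergodic map, the Birkhoff sums of a function of negative mean are almost surely bounded
above. The set where they are not is invariant; if it had full measure, then
`Mₙ₊₁ - Mₙ ∘ T = max (-Mₙ ∘ T) f` would converge to `f`, while its integral is nonnegative. -/
lemma Ergodic.ae_bddAbove_birkhoffSum {E : Type*} [MeasurableSpace E] {P : Measure E}
    [IsProbabilityMeasure P] {T : E → E} (hT : Ergodic T P) {f : E → ℝ} (hf : Measurable f) {C : ℝ}
    (hC : ∀ x, |f x| ≤ C) (hneg : ∫ x, f x ∂P < 0) :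
    ∀ᵐ x ∂P, BddAbove (Set.range fun n => birkhoffSum T f n x) := by
  have hTm : Measurable T := hT.measurable
  set A : Set E := {x | BddAbove (Set.range fun n => birkhoffSum T f n x)} with hA
  have hSm : ∀ n, Measurable (birkhoffSum T f n) := fun n =>
    Finset.measurable_sum _ fun i _ => hf.comp (hTm.iterate i)
  have hAm : MeasurableSet A := measurableSet_bddAbove_range hSm
  have hinv : T ⁻¹' A = A := by
    ext x
    simp only [hA, Set.mem_preimage, Set.mem_ofPred_eq, bddAbove_def, Set.forall_mem_range]
    constructor
    · rintro ⟨M, hM⟩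
      refine ⟨max 0 (f x + M), fun n => ?_⟩
      cases n with
      | zero => simp
      | succ n => rw [birkhoffSum_succ']; exact le_max_of_le_right (by gcongr; exact hM n)
    · rintro ⟨M, hM⟩
      refine ⟨M - f x, fun n => ?_⟩
      have := hM (n + 1)
      rw [birkhoffSum_succ'] at this
      linarith
  rcases hT.toPreErgodic.ae_mem_or_ae_notMem hAm hinv with h | h
  · exact h
  exfalso
  have hdiv : ∀ᵐ x ∂P, Tendsto (fun n => birkhoffMax T f n (T x)) atTop atTop := by
    filter_upwards [h] with x hx
    refine tendsto_atTop_atTop_of_monotone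
      (monotone_nat_of_le_succ fun n => birkhoffMax_le_succ T f n (T x)) fun b => ?_
    have hx' : T x ∉ A := fun h' => hx (hinv ▸ h')
    simp only [hA, Set.mem_ofPred_eq, bddAbove_def, Set.forall_mem_range, not_exists, not_forall,
      not_le] at hx'
    obtain ⟨n, hn⟩ := hx' b
    exact ⟨n, hn.le.trans (birkhoffSum_le_birkhoffMax T f n (T x))⟩
  have hlim : Tendsto (fun n => ∫ x, max (-birkhoffMax T f n (T x)) (f x) ∂P) atTop
      (𝓝 (∫ x, f x ∂P)) := by
    refine tendsto_integral_of_dominated_convergence (fun _ => C)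
      (fun n => (((measurable_birkhoffMax hTm hf n).comp hTm).neg.max hf).aestronglyMeasurable)
      (integrable_const C) (fun n => ae_of_all _ fun x => ?_) ?_
    · have h0 := birkhoffMax_nonneg T f n (T x)
      have h1 := abs_le.1 (hC x)
      rw [Real.norm_eq_abs, abs_le]
      exact ⟨le_max_of_le_right h1.1, max_le (by linarith [abs_nonneg (f x), hC x]) h1.2⟩
    · filter_upwards [hdiv] with x hx
      refine tendsto_const_nhds.congr' ?_
      filter_upwards [hx.eventually_ge_atTop (-f x)] with n hn
      exact (max_eq_right (by linarith)).symm
  have hnonneg : ∀ n, 0 ≤ ∫ x, max (-birkhoffMax T f n (T x)) (f x) ∂P := by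
    intro n
    have hint := fun m => integrable_birkhoffMax (P := P) hTm hf hC m
    have hcomp : ∫ x, birkhoffMax T f n (T x) ∂P = ∫ x, birkhoffMax T f n x ∂P := by
      conv_rhs => rw [← hT.toMeasurePreserving.map_eq]
      exact (integral_map hTm.aemeasurable
        (measurable_birkhoffMax hTm hf n).aestronglyMeasurable).symm
    have hintT : Integrable (fun x => birkhoffMax T f n (T x)) P :=
      hT.toMeasurePreserving.integrable_comp_of_integrable (hint n)
    have heq : ∀ x, max (-birkhoffMax T f n (T x)) (f x)
        = birkhoffMax T f (n + 1) x - birkhoffMax T f n (T x) := by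
      intro x
      change _ = max 0 (f x + birkhoffMax T f n (T x)) - _
      rw [← max_sub_sub_right]
      simp
    simp_rw [heq]
    rw [integral_sub (hint (n + 1)) hintT, hcomp, sub_nonneg]
    exact integral_mono (hint n) (hint (n + 1)) fun x => birkhoffMax_le_succ T f n x
  exact absurd (ge_of_tendsto' hlim hnonneg) (not_le.2 hneg)

lemma Ergodic.ae_eventually_birkhoffSum_le {E : Type*} [MeasurableSpace E] {P : Measure E}
    [IsProbabilityMeasure P] {T : E → E} (hT : Ergodic T P) {f : E → ℝ} (hf : Measurable f) {C : ℝ}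
    (hC : ∀ x, |f x| ≤ C) {ε : ℝ} (hε : 0 < ε) :
    ∀ᵐ x ∂P, ∀ᶠ n : ℕ in atTop, birkhoffSum T f n x ≤ n * (∫ x, f x ∂P + ε) := by
  set c : ℝ := ∫ x, f x ∂P + ε / 2 with hc
  have hfi : Integrable f P := Integrable.of_bound hf.aestronglyMeasurable C (ae_of_all _ hC)
  have hmean : ∫ x, (f x - c) ∂P < 0 := by
    rw [integral_sub hfi (integrable_const _)]
    simp [hc]
    linarith
  have hbd : ∀ x, |f x - c| ≤ C + |c| := fun x => (abs_sub _ _).trans (by gcongr; exact hC x)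
  filter_upwards [hT.ae_bddAbove_birkhoffSum (hf.sub_const c) hbd hmean] with x ⟨M, hM⟩
  have hsum : ∀ n, birkhoffSum T (fun x => f x - c) n x = birkhoffSum T f n x - n * c := by
    intro n
    simp [birkhoffSum, Finset.sum_sub_distrib]
  filter_upwards [(tendsto_natCast_atTop_atTop.atTop_mul_const (half_pos hε)).eventually_ge_atTop M]
    with n hn
  have h1 : birkhoffSum T f n x - n * c ≤ M := hsum n ▸ hM ⟨n, rfl⟩
  rw [hc] at h1
  linarith

/-- Birkhoff's pointwise ergodic theorem, for a bounded function and an ergodic map. -/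
theorem Ergodic.ae_tendsto_birkhoffSum_div {E : Type*} [MeasurableSpace E] {P : Measure E}
    [IsProbabilityMeasure P] {T : E → E} (hT : Ergodic T P) {f : E → ℝ} (hf : Measurable f) {C : ℝ}
    (hC : ∀ x, |f x| ≤ C) :
    ∀ᵐ x ∂P, Tendsto (fun n : ℕ => birkhoffSum T f n x / n) atTop (𝓝 (∫ x, f x ∂P)) := by
  have hup : ∀ᵐ x ∂P, ∀ i : ℕ, ∀ᶠ n : ℕ in atTop,
      birkhoffSum T f n x ≤ n * (∫ x, f x ∂P + 1 / ((i : ℝ) + 1)) :=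
    ae_all_iff.2 fun i => hT.ae_eventually_birkhoffSum_le hf hC (by positivity)
  have hlo : ∀ᵐ x ∂P, ∀ i : ℕ, ∀ᶠ n : ℕ in atTop,
      birkhoffSum T (-f) n x ≤ n * (∫ x, (-f) x ∂P + 1 / ((i : ℝ) + 1)) :=
    ae_all_iff.2 fun i => hT.ae_eventually_birkhoffSum_le hf.neg (by simpa using hC)
      (by positivity)
  filter_upwards [hup, hlo] with x hx hx'
  rw [Metric.tendsto_nhds]
  intro ε hε
  obtain ⟨i, hi⟩ := exists_nat_one_div_lt hε
  filter_upwards [hx i, hx' i, eventually_gt_atTop 0] with n h1 h2 hn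
  have hn' : (0 : ℝ) < n := by exact_mod_cast hn
  rw [birkhoffSum_neg] at h2
  simp only [Pi.neg_apply, integral_neg] at h2
  rw [Real.dist_eq, abs_lt, lt_sub_iff_add_lt, sub_lt_iff_lt_add', lt_div_iff₀ hn',
    div_lt_iff₀ hn']
  constructor <;> nlinarith

/-! ### Exponential tails for sums of bounded increments with a martingale property -/

/-- Azuma's inequality in exponential-moment form. The martingale property of the partial sums enters
only through the orthogonality of `exp (t * ∑ i < j, d i)` to the next increment `d j`. -/
lemma integral_exp_sum_le {Ω : Type*} [MeasurableSpace Ω] {μ : Measure Ω} [IsProbabilityMeasure μ]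
    {d : ℕ → Ω → ℝ} (hm : ∀ j, Measurable (d j)) (hb : ∀ j ω, |d j ω| ≤ 1) {t : ℝ} (ht : |t| ≤ 1)
    (horth : ∀ j, ∫ ω, Real.exp (t * ∑ i ∈ Finset.range j, d i ω) * d j ω ∂μ = 0) (n : ℕ) :
    Integrable (fun ω => Real.exp (t * ∑ i ∈ Finset.range n, d i ω)) μ ∧
      ∫ ω, Real.exp (t * ∑ i ∈ Finset.range n, d i ω) ∂μ ≤ Real.exp (n * t ^ 2) := by
  have hint : ∀ n, Integrable (fun ω => Real.exp (t * ∑ i ∈ Finset.range n, d i ω)) μ := by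
    intro n
    refine Integrable.of_bound (Real.measurable_exp.comp (measurable_const.mul
      (Finset.measurable_fun_sum _ fun i _ => hm i))).aestronglyMeasurable (Real.exp n)
      (ae_of_all _ fun ω => ?_)
    rw [Real.norm_of_nonneg (Real.exp_pos _).le]
    refine Real.exp_le_exp.2 ((le_abs_self _).trans ?_)
    rw [abs_mul]
    have hs : |∑ i ∈ Finset.range n, d i ω| ≤ n := by
      refine (Finset.abs_sum_le_sum_abs _ _).trans ((Finset.sum_le_sum fun i _ => hb i ω).trans ?_)
      simp
    exact (mul_le_of_le_one_left (abs_nonneg _) ht).trans hs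
  refine ⟨hint n, ?_⟩
  induction n with
  | zero => simp
  | succ n ih =>
    have hint' : Integrable (fun ω => Real.exp (t * ∑ i ∈ Finset.range n, d i ω) * d n ω) μ :=
      (hint n).mul_bdd (hm n).aestronglyMeasurable (ae_of_all _ (hb n))
    have hpt : ∀ ω, Real.exp (t * ∑ i ∈ Finset.range (n + 1), d i ω) ≤
        Real.exp (t ^ 2) * Real.exp (t * ∑ i ∈ Finset.range n, d i ω) +
          t * (Real.exp (t * ∑ i ∈ Finset.range n, d i ω) * d n ω) := by
      intro ω
      have hx : |t * d n ω| ≤ 1 := by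
        rw [abs_mul]; exact mul_le_one₀ ht (abs_nonneg _) (hb n ω)
      have h1 := (abs_le.1 (Real.abs_exp_sub_one_sub_id_le hx)).2
      have h2 : (t * d n ω) ^ 2 ≤ t ^ 2 := by
        rw [mul_pow]
        exact mul_le_of_le_one_right (sq_nonneg _) ((sq_le_one_iff_abs_le_one _).2 (hb n ω))
      have h3 := Real.add_one_le_exp (t ^ 2)
      rw [Finset.sum_range_succ, mul_add, Real.exp_add]
      have h4 : Real.exp (t * d n ω) ≤ Real.exp (t ^ 2) + t * d n ω := by linarith
      calc _ ≤ Real.exp (t * ∑ i ∈ Finset.range n, d i ω) * (Real.exp (t ^ 2) + t * d n ω) := by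
            gcongr
        _ = _ := by ring
    calc _ ≤ ∫ ω, (Real.exp (t ^ 2) * Real.exp (t * ∑ i ∈ Finset.range n, d i ω) +
          t * (Real.exp (t * ∑ i ∈ Finset.range n, d i ω) * d n ω)) ∂μ :=
          integral_mono (hint (n + 1)) (((hint n).const_mul _).add (hint'.const_mul _)) hpt
      _ = Real.exp (t ^ 2) * ∫ ω, Real.exp (t * ∑ i ∈ Finset.range n, d i ω) ∂μ := by
          rw [integral_add ((hint n).const_mul _) (hint'.const_mul _), integral_const_mul,
            integral_const_mul, horth n, mul_zero, add_zero]
      _ ≤ Real.exp (t ^ 2) * Real.exp (n * t ^ 2) := by gcongr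
      _ = _ := by rw [← Real.exp_add]; congr 1; push_cast; ring

/-- The deviation bound at scale `n ^ (3 / 4)`, from the exponential moments at `t = ± n ^ (-1 / 2)`. -/
lemma measureReal_abs_sum_ge_le {Ω : Type*} [MeasurableSpace Ω] {μ : Measure Ω}
    [IsProbabilityMeasure μ] {d : ℕ → Ω → ℝ} (hm : ∀ j, Measurable (d j))
    (hb : ∀ j ω, |d j ω| ≤ 1)
    (horth : ∀ t j, ∫ ω, Real.exp (t * ∑ i ∈ Finset.range j, d i ω) * d j ω ∂μ = 0)
    {n : ℕ} (hn : 0 < n) :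
    μ.real {ω | (n : ℝ) ^ (3 / 4 : ℝ) ≤ |∑ i ∈ Finset.range n, d i ω|} ≤
      2 * Real.exp (1 - (n : ℝ) ^ (1 / 4 : ℝ)) := by
  have hn0 : (0 : ℝ) < n := by exact_mod_cast hn
  have hn1 : (1 : ℝ) ≤ n := by exact_mod_cast hn
  set t : ℝ := (n : ℝ) ^ (-(1 / 2) : ℝ) with ht
  have ht0 : 0 ≤ t := by positivity
  have ht1 : t ≤ 1 := Real.rpow_le_one_of_one_le_of_nonpos hn1 (by norm_num)
  have hnt : n * t ^ 2 = 1 := by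
    rw [ht, ← Real.rpow_natCast, ← Real.rpow_mul hn0.le]
    norm_num
    rw [Real.rpow_neg_one, mul_inv_cancel₀ hn0.ne']
  have hte : t * (n : ℝ) ^ (3 / 4 : ℝ) = (n : ℝ) ^ (1 / 4 : ℝ) := by
    rw [ht, ← Real.rpow_add hn0]; norm_num
  have key : ∀ s : ℝ, |s| = 1 → μ.real {ω | (n : ℝ) ^ (3 / 4 : ℝ) ≤
      s * ∑ i ∈ Finset.range n, d i ω} ≤ Real.exp (1 - (n : ℝ) ^ (1 / 4 : ℝ)) := by
    intro s hs
    have hst : |t * s| ≤ 1 := by rw [abs_mul, hs, mul_one, abs_of_nonneg ht0]; exact ht1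
    have hsq : s ^ 2 = 1 := by rw [← sq_abs, hs, one_pow]
    obtain ⟨hi, hle⟩ := integral_exp_sum_le hm hb hst (horth (t * s)) n
    simp only [mul_assoc] at hi hle
    refine (measure_ge_le_exp_mul_mgf _ ht0 hi).trans ?_
    calc _ ≤ Real.exp (-t * (n : ℝ) ^ (3 / 4 : ℝ)) * Real.exp (n * (t * s) ^ 2) := by
          gcongr; exact hle
      _ = _ := by
          rw [mul_pow, hsq, mul_one, hnt, neg_mul, hte, ← Real.exp_add]; congr 1; ring
  have hsub : {ω | (n : ℝ) ^ (3 / 4 : ℝ) ≤ |∑ i ∈ Finset.range n, d i ω|} ⊆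
      {ω | (n : ℝ) ^ (3 / 4 : ℝ) ≤ 1 * ∑ i ∈ Finset.range n, d i ω} ∪
      {ω | (n : ℝ) ^ (3 / 4 : ℝ) ≤ (-1) * ∑ i ∈ Finset.range n, d i ω} := by
    intro ω hω
    rw [Set.mem_ofPred_eq, le_abs] at hω
    rcases hω with h | h
    · left; simpa using h
    · right; simpa using h
  calc _ ≤ _ := measureReal_mono hsub
    _ ≤ _ := measureReal_union_le _ _
    _ ≤ _ := by linarith [key 1 (by simp), key (-1) (by simp)]

/-! ### Words of a stationary Markov process -/

/-- The word of length `k` that starts at position `j` of the sequence `x`. -/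
def word {α : Type*} (x : ℕ → α) (j k : ℕ) : Fin k → α := fun t => x (j + t)

lemma word_eq_iff {α : Type*} {x y : ℕ → α} {i j k : ℕ} :
    word x i k = word y j k ↔ ∀ t < k, x (i + t) = y (j + t) := by
  rw [funext_iff, Fin.forall_iff]
  rfl

lemma init_word {α : Type*} (x : ℕ → α) (j k : ℕ) : Fin.init (word x j (k + 1)) = word x j k := rfl

lemma word_iterate_seqShift {α : Type*} (x : ℕ → α) (j k : ℕ) :
    word (seqShift^[j] x) 0 k = word x j k := by
  induction j generalizing x with
  | zero => rfl
  | succ j ih =>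
    rw [Function.iterate_succ_apply, ih]
    funext t
    simp only [word, seqShift]
    congr 1; omega

lemma blockDist_nonneg {Ω α : Type*} [MeasurableSpace Ω] (μ : Measure Ω) (X : ℕ → Ω → α) (k : ℕ)
    (a : Fin k → α) : 0 ≤ blockDist μ X k a := measureReal_nonneg

lemma blockDist_eq_word {Ω α : Type*} [MeasurableSpace Ω] (μ : Measure Ω) (X : ℕ → Ω → α) (k : ℕ)
    (a : Fin k → α) : blockDist μ X k a = μ.real {ω | word (fun i => X i ω) 0 k = a} := by
  simp only [blockDist]
  unfold word
  simp only [zero_add]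

lemma measurable_word {Ω α : Type*} [MeasurableSpace Ω] [MeasurableSpace α] {X : ℕ → Ω → α}
    (hX : ∀ i, Measurable (X i)) (j k : ℕ) : Measurable fun ω => word (fun i => X i ω) j k :=
  measurable_pi_lambda _ fun t => hX (j + t)

lemma measurableSet_word_eq {Ω α : Type*} [MeasurableSpace Ω] [MeasurableSpace α] [Countable α]
    [MeasurableSingletonClass α] {X : ℕ → Ω → α} (hX : ∀ i, Measurable (X i)) (j k : ℕ)
    (a : Fin k → α) : MeasurableSet {ω | word (fun i => X i ω) j k = a} :=
  measurable_word hX j k (measurableSet_singleton a)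

/-- Stationarity: the law of a word does not depend on its position. -/
lemma measureReal_word_eq {Ω α : Type*} [MeasurableSpace Ω] {μ : Measure Ω} [MeasurableSpace α]
    [Countable α] [MeasurableSingletonClass α] {X : ℕ → Ω → α} (hX : ∀ i, Measurable (X i))
    (hstat : IsStationaryErgodic μ X) (j k : ℕ) (a : Fin k → α) :
    μ.real {ω | word (fun i => X i ω) j k = a} = blockDist μ X k a := by
  have hpath : Measurable fun ω i => X i ω := measurable_pi_lambda _ hX
  have hcyl : MeasurableSet {x : ℕ → α | word x 0 k = a} :=
    measurableSet_word_eq (X := fun i (x : ℕ → α) => x i) (fun i => measurable_pi_apply i) 0 k a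
  have hmp := Ergodic.toMeasurePreserving hstat
  have h := (hmp.iterate j).measureReal_preimage hcyl.nullMeasurableSet
  rw [map_measureReal_apply hpath hcyl, map_measureReal_apply hpath
    ((hmp.iterate j).measurable hcyl)] at h
  rw [blockDist_eq_word, ← Set.preimage_ofPred_eq (p := fun x : ℕ → α => word x 0 k = a), ← h]
  congr 1
  ext ω
  simp [word_iterate_seqShift]

lemma blockDist_succ_le_init {Ω α : Type*} [MeasurableSpace Ω] (μ : Measure Ω) [IsFiniteMeasure μ]
    (X : ℕ → Ω → α) (k : ℕ) (a : Fin (k + 1) → α) :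
    blockDist μ X (k + 1) a ≤ blockDist μ X k (Fin.init a) := by
  rw [blockDist_eq_word, blockDist_eq_word]
  refine measureReal_mono fun ω hω => ?_
  rw [Set.mem_ofPred_eq] at hω ⊢
  rw [← hω, init_word]

lemma blockDist_word_le {Ω α : Type*} [MeasurableSpace Ω] {μ : Measure Ω} [IsFiniteMeasure μ]
    [MeasurableSpace α] [Countable α] [MeasurableSingletonClass α] {X : ℕ → Ω → α}
    (hX : ∀ i, Measurable (X i)) (hstat : IsStationaryErgodic μ X) (y : ℕ → α) {i j k N : ℕ}
    (hi : i ≤ j) (h : j + k ≤ i + N) :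
    blockDist μ X N (word y i N) ≤ blockDist μ X k (word y j k) := by
  rw [← measureReal_word_eq hX hstat i, ← measureReal_word_eq hX hstat j]
  refine measureReal_mono fun ω hω => ?_
  rw [Set.mem_ofPred_eq, word_eq_iff] at hω ⊢
  intro t ht
  have := hω (j - i + t) (by omega)
  rwa [show i + (j - i + t) = j + t by omega] at this

/-- The Markov property, cleared of denominators. -/
lemma IsMarkovOfOrder.blockDist_mul {Ω α : Type*} [MeasurableSpace Ω] {μ : Measure Ω}
    [IsProbabilityMeasure μ] [MeasurableSpace α] [Countable α] [MeasurableSingletonClass α]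
    {X : ℕ → Ω → α} (hX : ∀ i, Measurable (X i)) (hstat : IsStationaryErgodic μ X) {l : ℕ}
    (hmarkov : IsMarkovOfOrder μ X l) (m : ℕ) (y : ℕ → α) :
    blockDist μ X (m + l + 1) (word y 0 (m + l + 1)) * blockDist μ X l (word y m l) =
      blockDist μ X (m + l) (word y 0 (m + l)) * blockDist μ X (l + 1) (word y m (l + 1)) := by
  have hle1 := blockDist_word_le hX hstat y (i := 0) (j := 0) (k := m + l) (N := m + l + 1)
    (by omega) (by omega)
  have hle2 := blockDist_word_le hX hstat y (i := 0) (j := m) (k := l) (N := m + l)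
    (by omega) (by omega)
  rcases (blockDist_nonneg μ X (m + l) (word y 0 (m + l))).eq_or_lt with h0 | hpos
  · rw [← h0] at hle1 ⊢
    rw [le_antisymm hle1 (blockDist_nonneg ..), zero_mul, zero_mul]
  have hA : {ω | ∀ i < m + l, X i ω = y i} =
      {ω | word (fun i => X i ω) 0 (m + l) = word y 0 (m + l)} := by
    ext ω
    rw [Set.mem_ofPred_eq, Set.mem_ofPred_eq, word_eq_iff]
    simp only [zero_add]
  have hC : {ω | ∀ i, m ≤ i → i < m + l → X i ω = y i} =
      {ω | word (fun i => X i ω) m l = word y m l} := by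
    ext ω
    rw [Set.mem_ofPred_eq, Set.mem_ofPred_eq, word_eq_iff]
    refine ⟨fun h t ht => h _ (by omega) (by omega), fun h i h1 h2 => ?_⟩
    have := h (i - m) (by omega)
    rwa [Nat.add_sub_cancel' h1] at this
  have hAB : {ω | word (fun i => X i ω) 0 (m + l) = word y 0 (m + l)} ∩
      {ω | X (m + l) ω = y (m + l)} =
      {ω | word (fun i => X i ω) 0 (m + l + 1) = word y 0 (m + l + 1)} := by
    ext ω
    simp only [Set.mem_inter_iff, Set.mem_ofPred_eq, word_eq_iff, Nat.forall_lt_succ_right,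
      zero_add]
  have hCB : {ω | word (fun i => X i ω) m l = word y m l} ∩ {ω | X (m + l) ω = y (m + l)} =
      {ω | word (fun i => X i ω) m (l + 1) = word y m (l + 1)} := by
    ext ω
    simp only [Set.mem_inter_iff, Set.mem_ofPred_eq, word_eq_iff, Nat.forall_lt_succ_right]
  have hne : μ {ω | ∀ i < m + l, X i ω = y i} ≠ 0 := by
    intro h
    rw [hA] at h
    rw [← measureReal_word_eq hX hstat 0, measureReal_def, h] at hpos
    simp at hpos
  have h := hmarkov m y hne
  rw [hA, hC, cond_apply (measurableSet_word_eq hX _ _ _),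
    cond_apply (measurableSet_word_eq hX _ _ _), hAB, hCB] at h
  have h' := congrArg ENNReal.toReal h
  simp only [ENNReal.toReal_mul, ENNReal.toReal_inv, ← measureReal_def,
    measureReal_word_eq hX hstat] at h'
  have h2 := hpos.trans_le hle2
  field_simp at h'
  linarith

/-- For `k` at least the Markov order, the last `k` symbols of the past determine the conditional law
of the next one. -/
lemma IsMarkovOfOrder.blockDist_mul_of_le {Ω α : Type*} [MeasurableSpace Ω] {μ : Measure Ω}
    [IsProbabilityMeasure μ] [MeasurableSpace α] [Countable α] [MeasurableSingletonClass α]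
    {X : ℕ → Ω → α} (hX : ∀ i, Measurable (X i)) (hstat : IsStationaryErgodic μ X) {l : ℕ}
    (hmarkov : IsMarkovOfOrder μ X l) {k : ℕ} (hk : l ≤ k) (j : ℕ) (y : ℕ → α) :
    blockDist μ X (j + k + 1) (word y 0 (j + k + 1)) * blockDist μ X k (word y j k) =
      blockDist μ X (j + k) (word y 0 (j + k)) * blockDist μ X (k + 1) (word y j (k + 1)) := by
  obtain ⟨m, rfl⟩ := Nat.exists_eq_add_of_le' hk
  have h1 := hmarkov.blockDist_mul hX hstat (j + m) y
  have h2 := hmarkov.blockDist_mul hX hstat m (fun i => y (j + i))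
  have hw : ∀ i k, word (fun i => y (j + i)) i k = word y (j + i) k := fun i k => by
    funext t; simp [word, add_assoc]
  simp only [hw, add_zero] at h2
  rw [add_assoc j m l] at h1
  have hle1 := blockDist_word_le hX hstat y (i := 0) (j := 0) (k := j + (m + l))
    (N := j + (m + l) + 1) (by omega) (by omega)
  have hle2 := blockDist_word_le hX hstat y (i := 0) (j := j + m) (k := l) (N := j + (m + l))
    (by omega) (by omega)
  rcases (blockDist_nonneg μ X l (word y (j + m) l)).eq_or_lt with h0 | hpos
  · have hz : blockDist μ X (j + (m + l)) (word y 0 (j + (m + l))) = 0 :=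
      le_antisymm (hle2.trans h0.symm.le) (blockDist_nonneg ..)
    rw [hz] at hle1 ⊢
    rw [le_antisymm hle1 (blockDist_nonneg ..), zero_mul, zero_mul]
  · refine mul_right_cancel₀ hpos.ne' ?_
    linear_combination blockDist μ X (m + l) (word y j (m + l)) * h1 -
      blockDist μ X (j + (m + l)) (word y 0 (j + (m + l))) * h2

/-! ### Martingale increments attached to a word -/

/-- The conditional probability that the last symbol of `a` follows its other symbols. It is `0` when
these have probability `0`, which keeps `blockDist_eq_transProb_mul` true. -/
noncomputable def transProb {Ω α : Type*} [MeasurableSpace Ω] (μ : Measure Ω) (X : ℕ → Ω → α)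
    (k : ℕ) (a : Fin (k + 1) → α) : ℝ :=
  blockDist μ X (k + 1) a / blockDist μ X k (Fin.init a)

lemma transProb_nonneg {Ω α : Type*} [MeasurableSpace Ω] (μ : Measure Ω) (X : ℕ → Ω → α)
    (k : ℕ) (a : Fin (k + 1) → α) : 0 ≤ transProb μ X k a :=
  div_nonneg (blockDist_nonneg ..) (blockDist_nonneg ..)

lemma transProb_le_one {Ω α : Type*} [MeasurableSpace Ω] (μ : Measure Ω) [IsFiniteMeasure μ]
    (X : ℕ → Ω → α) (k : ℕ) (a : Fin (k + 1) → α) : transProb μ X k a ≤ 1 :=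
  div_le_one_of_le₀ (blockDist_succ_le_init ..) (blockDist_nonneg ..)

lemma blockDist_eq_transProb_mul {Ω α : Type*} [MeasurableSpace Ω] (μ : Measure Ω)
    [IsFiniteMeasure μ] (X : ℕ → Ω → α) (k : ℕ) (a : Fin (k + 1) → α) :
    blockDist μ X (k + 1) a = transProb μ X k a * blockDist μ X k (Fin.init a) := by
  rcases (blockDist_nonneg μ X k (Fin.init a)).eq_or_lt with h0 | hpos
  · have h := blockDist_succ_le_init μ X k a
    rw [← h0] at h ⊢
    rw [mul_zero]
    exact le_antisymm h (blockDist_nonneg ..)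
  · exact (div_mul_cancel₀ _ hpos.ne').symm

/-- The contribution of position `j` to the number of occurrences of `a` in excess of what the
occurrences of `Fin.init a` predict. -/
noncomputable def excess {Ω α : Type*} [MeasurableSpace Ω] [DecidableEq α] (μ : Measure Ω)
    (X : ℕ → Ω → α) (k : ℕ) (a : Fin (k + 1) → α) (j : ℕ) (x : ℕ → α) : ℝ :=
  (if word x j (k + 1) = a then 1 else 0) -
    (if word x j k = Fin.init a then transProb μ X k a else 0)

lemma abs_excess_le_one {Ω α : Type*} [MeasurableSpace Ω] [DecidableEq α] (μ : Measure Ω)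
    [IsFiniteMeasure μ] (X : ℕ → Ω → α) (k : ℕ) (a : Fin (k + 1) → α) (j : ℕ) (x : ℕ → α) :
    |excess μ X k a j x| ≤ 1 := by
  have h0 := transProb_nonneg μ X k a
  have h1 := transProb_le_one μ X k a
  unfold excess
  rw [abs_le]
  constructor <;> split_ifs <;> linarith

lemma excess_congr {Ω α : Type*} [MeasurableSpace Ω] [DecidableEq α] (μ : Measure Ω)
    (X : ℕ → Ω → α) (k : ℕ) (a : Fin (k + 1) → α) {j N : ℕ} (h : j + k < N) {x y : ℕ → α}
    (hxy : word x 0 N = word y 0 N) : excess μ X k a j x = excess μ X k a j y := by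
  rw [word_eq_iff] at hxy
  have h1 : word x j (k + 1) = word y j (k + 1) := word_eq_iff.2 fun t ht => by
    simpa using hxy (j + t) (by omega)
  have h2 : word x j k = word y j k := word_eq_iff.2 fun t ht => by
    simpa using hxy (j + t) (by omega)
  rw [excess, excess, h1, h2]

lemma measurable_excess {Ω α : Type*} [MeasurableSpace Ω] [DecidableEq α] [MeasurableSpace α]
    [Countable α] [MeasurableSingletonClass α] (μ : Measure Ω) {X : ℕ → Ω → α}
    (hX : ∀ i, Measurable (X i)) (k : ℕ) (a : Fin (k + 1) → α) (j : ℕ) :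
    Measurable fun ω => excess μ X k a j fun i => X i ω :=
  (Measurable.ite (measurableSet_word_eq hX j (k + 1) a) measurable_const measurable_const).sub
    (Measurable.ite (measurableSet_word_eq hX j k (Fin.init a)) measurable_const measurable_const)

/-- The martingale property on a single past `w`. -/
lemma integral_ite_excess {Ω α : Type*} [MeasurableSpace Ω] {μ : Measure Ω}
    [IsProbabilityMeasure μ] [DecidableEq α] [MeasurableSpace α] [Countable α]
    [MeasurableSingletonClass α] {X : ℕ → Ω → α} (hX : ∀ i, Measurable (X i))
    (hstat : IsStationaryErgodic μ X) {l : ℕ} (hmarkov : IsMarkovOfOrder μ X l) {k : ℕ}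
    (hk : l ≤ k) (a : Fin (k + 1) → α) (j : ℕ) (w : Fin (j + k) → α) :
    ∫ ω, (if word (fun i => X i ω) 0 (j + k) = w then
      excess μ X k a j (fun i => X i ω) else 0) ∂μ = 0 := by
  by_cases hw : ∃ ω₀, word (fun i => X i ω₀) 0 (j + k) = w
  swap
  · simp only [not_exists] at hw
    simp [hw]
  obtain ⟨ω₀, hw⟩ := hw
  -- `y` continues the past `w` by the last symbol of `a`.
  set y : ℕ → α := fun i => if i < j + k then X i ω₀ else a (Fin.last k) with hy
  have hwy : w = word y 0 (j + k) := by
    rw [← hw, word_eq_iff]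
    intro t ht
    simp [hy, ht]
  by_cases ha : word y j k = Fin.init a
  · have hay : a = word y j (k + 1) := by
      rw [← Fin.snoc_init_self a, ← ha]
      funext t
      refine Fin.lastCases ?_ (fun t => ?_) t
      · simp [word, hy]
      · simp [word]
    have hpt : ∀ ω, (if word (fun i => X i ω) 0 (j + k) = w then
        excess μ X k a j (fun i => X i ω) else 0) =
        Set.indicator {ω | word (fun i => X i ω) 0 (j + k + 1) = word y 0 (j + k + 1)} 1 ω -
        transProb μ X k a *
          Set.indicator {ω | word (fun i => X i ω) 0 (j + k) = word y 0 (j + k)} 1 ω := by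
      intro ω
      rw [hwy, excess, ← ha]
      conv_lhs => rw [hay]
      simp only [Set.indicator_apply, Set.mem_ofPred_eq, Pi.one_apply, word_eq_iff,
        Nat.forall_lt_succ_right, zero_add]
      by_cases h : ∀ t < j + k, X t ω = y t
      · have h' : ∀ t < k, X (j + t) ω = y (j + t) := fun t ht => h _ (by omega)
        simp only [eq_true h, eq_true h', true_and, if_true, ← hay, mul_one]
      · simp [h]
    simp_rw [hpt]
    have hi : ∀ N, Integrable (Set.indicator
        {ω | word (fun i => X i ω) 0 N = word y 0 N} (1 : Ω → ℝ)) μ := fun N =>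
      (integrable_const (1 : ℝ)).indicator (measurableSet_word_eq hX _ _ _)
    rw [integral_sub (hi _) ((hi _).const_mul _), integral_const_mul,
      integral_indicator_one (measurableSet_word_eq hX _ _ _),
      integral_indicator_one (measurableSet_word_eq hX _ _ _), measureReal_word_eq hX hstat,
      measureReal_word_eq hX hstat, transProb, ← ha, hay]
    have h := hmarkov.blockDist_mul_of_le hX hstat hk j y
    have hle1 := blockDist_word_le hX hstat y (i := 0) (j := 0) (k := j + k)
      (N := j + k + 1) (by omega) (by omega)
    have hle2 := blockDist_word_le hX hstat y (i := 0) (j := j) (k := k) (N := j + k)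
      (by omega) (by omega)
    rcases (blockDist_nonneg μ X k (word y j k)).eq_or_lt with h0 | hpos
    · have hz : blockDist μ X (j + k) (word y 0 (j + k)) = 0 :=
        le_antisymm (hle2.trans h0.symm.le) (blockDist_nonneg ..)
      rw [hz] at hle1 ⊢
      rw [le_antisymm hle1 (blockDist_nonneg ..)]
      simp
    · field_simp
      linarith
  · have hpt : ∀ ω, (if word (fun i => X i ω) 0 (j + k) = w then
        excess μ X k a j (fun i => X i ω) else 0) = 0 := by
      intro ω
      split_ifs with h
      · have h1 : word (fun i => X i ω) j k = word y j k := by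
          rw [hwy, word_eq_iff] at h
          exact word_eq_iff.2 fun t ht => by simpa using h (j + t) (by omega)
        have h2 : word (fun i => X i ω) j k ≠ Fin.init a := h1 ▸ ha
        have h3 : word (fun i => X i ω) j (k + 1) ≠ a := fun h' => h2 (by rw [← h', init_word])
        simp [excess, h2, h3]
      · rfl
    simp [hpt]

lemma integral_mul_excess {Ω α : Type*} [MeasurableSpace Ω] {μ : Measure Ω}
    [IsProbabilityMeasure μ] [Fintype α] [DecidableEq α] [MeasurableSpace α]
    [MeasurableSingletonClass α] {X : ℕ → Ω → α} (hX : ∀ i, Measurable (X i))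
    (hstat : IsStationaryErgodic μ X) {l : ℕ} (hmarkov : IsMarkovOfOrder μ X l) {k : ℕ}
    (hk : l ≤ k) (a : Fin (k + 1) → α) (j : ℕ) {g : Ω → ℝ}
    (hg : g.FactorsThrough fun ω => word (fun i => X i ω) 0 (j + k)) :
    ∫ ω, g ω * excess μ X k a j (fun i => X i ω) ∂μ = 0 := by
  obtain ⟨φ, rfl⟩ := (Function.factorsThrough_iff g).1 hg
  have hpt : ∀ ω, (φ ∘ fun ω => word (fun i => X i ω) 0 (j + k)) ω *
      excess μ X k a j (fun i => X i ω) = ∑ w : Fin (j + k) → α, φ w *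
        (if word (fun i => X i ω) 0 (j + k) = w then
          excess μ X k a j (fun i => X i ω) else 0) := by
    intro ω
    simp
  simp_rw [hpt]
  rw [integral_finsetSum]
  · simp_rw [integral_const_mul, integral_ite_excess hX hstat hmarkov hk, mul_zero,
      Finset.sum_const_zero]
  · intro w _
    refine Integrable.const_mul (Integrable.of_bound (Measurable.ite
      (measurableSet_word_eq hX _ _ _) (measurable_excess μ hX k a j)
      measurable_const).aestronglyMeasurable 1 (ae_of_all _ fun ω => ?_)) _
    split_ifs
    · exact abs_excess_le_one ..
    · simp

lemma measureReal_abs_sum_excess_ge_le {Ω α : Type*} [MeasurableSpace Ω] {μ : Measure Ω}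
    [IsProbabilityMeasure μ] [Fintype α] [DecidableEq α] [MeasurableSpace α]
    [MeasurableSingletonClass α] {X : ℕ → Ω → α} (hX : ∀ i, Measurable (X i))
    (hstat : IsStationaryErgodic μ X) {l : ℕ} (hmarkov : IsMarkovOfOrder μ X l) {k : ℕ}
    (hk : l ≤ k) (a : Fin (k + 1) → α) {n : ℕ} (hn : 0 < n) :
    μ.real {ω | (n : ℝ) ^ (3 / 4 : ℝ) ≤
      |∑ j ∈ Finset.range n, excess μ X k a j (fun i => X i ω)|} ≤
      2 * Real.exp (1 - (n : ℝ) ^ (1 / 4 : ℝ)) := by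
  refine measureReal_abs_sum_ge_le (fun j => measurable_excess μ hX k a j)
    (fun j ω => abs_excess_le_one ..) (fun t j => ?_) hn
  refine integral_mul_excess hX hstat hmarkov hk a j fun ω ω' h => ?_
  rw [Finset.sum_congr rfl fun i hi => excess_congr μ X k a
    (by have := Finset.mem_range.1 hi; omega) h]

/-! ### Empirical frequencies of words -/

/-- The frequency of the word `a` among the first `n` windows of `x`, without wrapping around: the
windows may reach beyond position `n`. -/
noncomputable def blockFreq {α : Type*} [DecidableEq α] (n k : ℕ) (x : ℕ → α) (a : Fin k → α) : ℝ :=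
  (((Finset.range n).filter fun j => word x j k = a).card : ℝ) / n

lemma blockFreq_eq_sum {α : Type*} [DecidableEq α] (n k : ℕ) (x : ℕ → α) (a : Fin k → α) :
    blockFreq n k x a = (∑ j ∈ Finset.range n, if word x j k = a then (1 : ℝ) else 0) / n := by
  rw [blockFreq, Finset.sum_boole]

/-- Cyclic and noncyclic windows differ only at the last `k` positions. -/
lemma sum_abs_empiricalDist_sub_blockFreq_le {α : Type*} [Fintype α] [DecidableEq α] (n k : ℕ)
    (x : ℕ → α) :
    ∑ a : Fin k → α, |empiricalDist n k x a - blockFreq n k x a| ≤ 2 * k / n := by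
  have hterm : ∀ j, ∑ a : Fin k → α,
      |(if (fun t : Fin k => x ((j + (t : ℕ)) % n)) = a then (1 : ℝ) else 0) -
        (if word x j k = a then 1 else 0)| ≤ if n < j + k then 2 else 0 := by
    intro j
    split_ifs with h
    · calc _ ≤ ∑ a : Fin k → α,
          ((if (fun t : Fin k => x ((j + (t : ℕ)) % n)) = a then (1 : ℝ) else 0) +
          (if word x j k = a then 1 else 0)) := by
            refine Finset.sum_le_sum fun a _ => ?_
            split_ifs <;> norm_num
        _ = 2 := by rw [Finset.sum_add_distrib]; simp; norm_num
    · have : (fun t : Fin k => x ((j + (t : ℕ)) % n)) = word x j k := by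
        funext t
        rw [Nat.mod_eq_of_lt (by omega)]
        rfl
      simp [this]
  have hcard : ∑ j ∈ Finset.range n, (if n < j + k then (2 : ℝ) else 0) ≤ 2 * k := by
    rw [← Finset.sum_filter, Finset.sum_const, nsmul_eq_mul, mul_comm]
    have hsub : (Finset.range n).filter (fun j => n < j + k) ⊆ Finset.Ico (n - k) n := by
      intro j hj
      rw [Finset.mem_filter, Finset.mem_range] at hj
      rw [Finset.mem_Ico]
      omega
    have hle := Finset.card_le_card hsub
    rw [Nat.card_Ico] at hle
    have : ((Finset.range n).filter (fun j => n < j + k)).card ≤ k := by omega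
    gcongr
  calc _ = (∑ a : Fin k → α, |∑ j ∈ Finset.range n,
        ((if (fun t : Fin k => x ((j + (t : ℕ)) % n)) = a then (1 : ℝ) else 0) -
        (if word x j k = a then 1 else 0))|) / n := by
        rw [Finset.sum_div]
        refine Finset.sum_congr rfl fun a _ => ?_
        rw [empiricalDist, ← Finset.sum_boole, blockFreq_eq_sum, ← sub_div,
          ← Finset.sum_sub_distrib, abs_div, Nat.abs_cast]
    _ ≤ (∑ a : Fin k → α, ∑ j ∈ Finset.range n,
        |(if (fun t : Fin k => x ((j + (t : ℕ)) % n)) = a then (1 : ℝ) else 0) -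
        (if word x j k = a then 1 else 0)|) / n := by
        gcongr
        exact Finset.abs_sum_le_sum_abs _ _
    _ ≤ 2 * k / n := by
        rw [Finset.sum_comm]
        gcongr
        exact (Finset.sum_le_sum fun j _ => hterm j).trans hcard

lemma sum_word_succ {α : Type*} [Fintype α] {k : ℕ} (F : (Fin (k + 1) → α) → ℝ) :
    ∑ a, F a = ∑ b : Fin k → α, ∑ c : α, F (Fin.snoc (α := fun _ => α) b c) := by
  rw [← (Fin.snocEquiv fun _ => α).sum_comp, Fintype.sum_prod_type_right]
  rfl

lemma sum_transProb_snoc_le_one {Ω α : Type*} [MeasurableSpace Ω] (μ : Measure Ω)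
    [IsFiniteMeasure μ] [Fintype α] [MeasurableSpace α] [MeasurableSingletonClass α]
    {X : ℕ → Ω → α} (hX : ∀ i, Measurable (X i)) (k : ℕ) (b : Fin k → α) :
    ∑ c, transProb μ X k (Fin.snoc (α := fun _ => α) b c) ≤ 1 := by
  simp only [transProb, Fin.init_snoc]
  rw [← Finset.sum_div]
  refine div_le_one_of_le₀ ?_ (blockDist_nonneg ..)
  simp only [blockDist_eq_word]
  rw [← measureReal_iUnion_fintype]
  · refine measureReal_mono (Set.iUnion_subset fun c ω hω => ?_)
    rw [Set.mem_ofPred_eq] at hω ⊢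
    rw [← init_word, hω, Fin.init_snoc]
  · intro c c' hcc
    refine Set.disjoint_left.2 fun ω h h' => hcc ?_
    rw [Set.mem_ofPred_eq] at h h'
    have := congrFun (h.symm.trans h') (Fin.last k)
    simpa using this
  · exact fun c => measurableSet_word_eq hX _ _ _

/-- Lengthening the words by one symbol increases the distance by at most the fluctuation of the
martingales attached to the longer words. -/
lemma sum_abs_blockFreq_sub_succ_le {Ω α : Type*} [MeasurableSpace Ω] (μ : Measure Ω)
    [IsFiniteMeasure μ] [Fintype α] [DecidableEq α] [MeasurableSpace α]
    [MeasurableSingletonClass α] {X : ℕ → Ω → α} (hX : ∀ i, Measurable (X i)) (n k : ℕ)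
    (x : ℕ → α) :
    ∑ a, |blockFreq n (k + 1) x a - blockDist μ X (k + 1) a| ≤
      ∑ b, |blockFreq n k x b - blockDist μ X k b| +
        (∑ a, |∑ j ∈ Finset.range n, excess μ X k a j x|) / n := by
  have hpt : ∀ a, |blockFreq n (k + 1) x a - blockDist μ X (k + 1) a| ≤
      transProb μ X k a * |blockFreq n k x (Fin.init a) - blockDist μ X k (Fin.init a)| +
        |∑ j ∈ Finset.range n, excess μ X k a j x| / n := by
    intro a
    have hsum : (∑ j ∈ Finset.range n, excess μ X k a j x) / n =
        blockFreq n (k + 1) x a - transProb μ X k a * blockFreq n k x (Fin.init a) := by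
      simp only [excess, Finset.sum_sub_distrib]
      rw [sub_div, blockFreq_eq_sum, blockFreq_eq_sum, ← mul_div_assoc, Finset.mul_sum]
      simp
    have heq : blockFreq n (k + 1) x a - blockDist μ X (k + 1) a =
        transProb μ X k a * (blockFreq n k x (Fin.init a) - blockDist μ X k (Fin.init a)) +
          (∑ j ∈ Finset.range n, excess μ X k a j x) / n := by
      rw [hsum, blockDist_eq_transProb_mul]
      ring
    rw [heq]
    refine (abs_add_le _ _).trans_eq ?_
    rw [abs_mul, abs_of_nonneg (transProb_nonneg ..), abs_div, Nat.abs_cast]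
  refine (Finset.sum_le_sum fun a _ => hpt a).trans ?_
  rw [Finset.sum_add_distrib, ← Finset.sum_div]
  gcongr
  rw [sum_word_succ]
  refine Finset.sum_le_sum fun b _ => ?_
  simp only [Fin.init_snoc]
  rw [← Finset.sum_mul]
  exact mul_le_of_le_one_left (abs_nonneg _) (sum_transProb_snoc_le_one μ hX k b)

lemma sum_abs_blockFreq_sub_le {Ω α : Type*} [MeasurableSpace Ω] (μ : Measure Ω)
    [IsFiniteMeasure μ] [Fintype α] [DecidableEq α] [MeasurableSpace α]
    [MeasurableSingletonClass α] {X : ℕ → Ω → α} (hX : ∀ i, Measurable (X i)) (n l k : ℕ)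
    (x : ℕ → α) :
    ∑ a, |blockFreq n k x a - blockDist μ X k a| ≤
      ∑ i ∈ Finset.range (l + 1), ∑ b, |blockFreq n i x b - blockDist μ X i b| +
        ∑ m ∈ Finset.Ico l k, (∑ a, |∑ j ∈ Finset.range n, excess μ X m a j x|) / n := by
  have hshort : ∀ i ≤ l, ∑ a, |blockFreq n i x a - blockDist μ X i a| ≤
      ∑ i ∈ Finset.range (l + 1), ∑ b, |blockFreq n i x b - blockDist μ X i b| := fun i hi =>
    Finset.single_le_sum (f := fun i => ∑ b, |blockFreq n i x b - blockDist μ X i b|)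
      (fun i _ => Finset.sum_nonneg fun _ _ => abs_nonneg _) (Finset.mem_range.2 (by omega))
  rcases le_total k l with hkl | hlk
  · rw [Finset.Ico_eq_empty_of_le hkl, Finset.sum_empty, add_zero]
    exact hshort k hkl
  · induction k, hlk using Nat.le_induction with
    | base => simpa using hshort l le_rfl
    | succ k hlk ih =>
      rw [Finset.sum_Ico_succ_top hlk, ← add_assoc]
      exact (sum_abs_blockFreq_sub_succ_le μ hX n k x).trans (by gcongr)

/-! ### Almost sure convergence -/

lemma ae_tendsto_blockFreq {Ω α : Type*} [MeasurableSpace Ω] {μ : Measure Ω}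
    [IsProbabilityMeasure μ] [Countable α] [DecidableEq α] [MeasurableSpace α]
    [MeasurableSingletonClass α] {X : ℕ → Ω → α} (hX : ∀ i, Measurable (X i))
    (hstat : IsStationaryErgodic μ X) (k : ℕ) (a : Fin k → α) :
    ∀ᵐ ω ∂μ, Tendsto (fun n => blockFreq n k (fun i => X i ω) a) atTop
      (𝓝 (blockDist μ X k a)) := by
  have hpath : Measurable fun ω i => X i ω := measurable_pi_lambda _ hX
  have : IsProbabilityMeasure (μ.map fun ω i => X i ω) :=
    Measure.isProbabilityMeasure_map hpath.aemeasurable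
  have hcyl : MeasurableSet {x : ℕ → α | word x 0 k = a} :=
    measurableSet_word_eq (X := fun i (x : ℕ → α) => x i) (fun i => measurable_pi_apply i) 0 k a
  set f : (ℕ → α) → ℝ := Set.indicator {x | word x 0 k = a} 1 with hf
  have hfm : Measurable f := measurable_one.indicator hcyl
  have hfb : ∀ x, |f x| ≤ 1 := by
    intro x
    rw [hf, Set.indicator_apply]
    split_ifs <;> simp
  have hint : ∫ x, f x ∂(μ.map fun ω i => X i ω) = blockDist μ X k a := by
    rw [hf, integral_indicator_one hcyl, map_measureReal_apply hpath hcyl, blockDist_eq_word]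
    rfl
  have h := ae_of_ae_map hpath.aemeasurable (Ergodic.ae_tendsto_birkhoffSum_div hstat hfm hfb)
  filter_upwards [h] with ω hω
  rw [hint] at hω
  refine hω.congr fun n => ?_
  rw [blockFreq_eq_sum, birkhoffSum]
  congr 1
  refine Finset.sum_congr rfl fun j _ => ?_
  rw [hf, Set.indicator_apply]
  simp [word_iterate_seqShift]

lemma sum_Ico_pow_succ_le {s : ℝ} (hs : 1 ≤ s) (l K : ℕ) :
    ∑ m ∈ Finset.Ico l K, s ^ (m + 1) ≤ (2 * s) ^ K := by
  calc _ ≤ ∑ m ∈ Finset.Ico l K, s ^ K := by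
        refine Finset.sum_le_sum fun m hm => pow_le_pow_right₀ hs ?_
        have := Finset.mem_Ico.1 hm
        omega
    _ = ((K - l : ℕ) : ℝ) * s ^ K := by simp
    _ ≤ 2 ^ K * s ^ K := by
        gcongr
        exact_mod_cast (Nat.sub_le K l).trans Nat.lt_two_pow_self.le
    _ = _ := (mul_pow ..).symm

lemma eventually_pow_le_rpow_of_isLittleO_log {k : ℕ → ℕ}
    (hk : (fun n : ℕ => (k n : ℝ)) =o[atTop] (fun n : ℕ => Real.log (n : ℝ))) {s : ℝ} (hs : 1 < s)
    {δ : ℝ} (hδ : 0 < δ) : ∀ᶠ n : ℕ in atTop, s ^ k n ≤ (n : ℝ) ^ δ := by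
  have hL : 0 < Real.log s := Real.log_pos hs
  filter_upwards [hk.def (c := δ / Real.log s) (by positivity), eventually_ge_atTop 1] with n hn h1
  have h1' : (1 : ℝ) ≤ n := by exact_mod_cast h1
  rw [Real.norm_of_nonneg (Nat.cast_nonneg _), Real.norm_of_nonneg (Real.log_nonneg h1')] at hn
  rw [← Real.rpow_natCast, Real.rpow_def_of_pos (by linarith), Real.rpow_def_of_pos (by linarith)]
  refine Real.exp_le_exp.2 ?_
  calc _ ≤ Real.log s * (δ / Real.log s * Real.log n) := by gcongr
    _ = _ := by field_simp

lemma summable_rpow_mul_exp_neg_rpow :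
    Summable fun n : ℕ => (n : ℝ) ^ (1 / 8 : ℝ) * (2 * Real.exp (1 - (n : ℝ) ^ (1 / 4 : ℝ))) := by
  have h1 : (fun n : ℕ => Real.exp (-1 * (n : ℝ) ^ (1 / 4 : ℝ))) =o[atTop]
      fun n : ℕ => ((n : ℝ) ^ (1 / 4 : ℝ)) ^ (-(17 / 2) : ℝ) :=
    (isLittleO_exp_neg_mul_rpow_atTop one_pos _).comp_tendsto
      ((tendsto_rpow_atTop (by norm_num)).comp tendsto_natCast_atTop_atTop)
  have h2 := ((isBigO_refl (fun n : ℕ => (n : ℝ) ^ (1 / 8 : ℝ)) atTop).mul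
    (h1.isBigO.const_mul_left (2 * Real.exp 1)))
  refine summable_of_isBigO_nat (Real.summable_nat_rpow.2 (show (-2 : ℝ) < -1 by norm_num)) ?_
  refine (h2.congr_left fun n => ?_).congr' EventuallyEq.rfl ?_
  · rw [sub_eq_add_neg, Real.exp_add]; ring_nf
  · filter_upwards [eventually_gt_atTop 0] with n hn
    have hn0 : (0 : ℝ) < n := by exact_mod_cast hn
    rw [← Real.rpow_mul hn0.le, ← Real.rpow_add hn0]
    norm_num

/-- There are only `n ^ o(1)` words of length at most `k n`, so the tail bound holds for all of them at
once, by the Borel–Cantelli lemma. -/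
lemma ae_eventually_abs_sum_excess_lt {Ω α : Type*} [MeasurableSpace Ω] {μ : Measure Ω}
    [IsProbabilityMeasure μ] [Fintype α] [Nonempty α] [DecidableEq α] [MeasurableSpace α]
    [MeasurableSingletonClass α] {X : ℕ → Ω → α} (hX : ∀ i, Measurable (X i))
    (hstat : IsStationaryErgodic μ X) {l : ℕ} (hmarkov : IsMarkovOfOrder μ X l) {k : ℕ → ℕ}
    (hk : (fun n : ℕ => (k n : ℝ)) =o[atTop] (fun n : ℕ => Real.log (n : ℝ))) :
    ∀ᵐ ω ∂μ, ∀ᶠ n : ℕ in atTop, ∀ m ∈ Finset.Ico l (k n), ∀ a : Fin (m + 1) → α,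
      |∑ j ∈ Finset.range n, excess μ X m a j (fun i => X i ω)| < (n : ℝ) ^ (3 / 4 : ℝ) := by
  have hs : (1 : ℝ) ≤ Fintype.card α := by exact_mod_cast Fintype.card_pos
  set B : ℕ → Set Ω := fun n => ⋃ m ∈ Finset.Ico l (k n), ⋃ a : Fin (m + 1) → α,
    {ω | (n : ℝ) ^ (3 / 4 : ℝ) ≤ |∑ j ∈ Finset.range n, excess μ X m a j (fun i => X i ω)|} with hB
  have hBle : ∀ᶠ n : ℕ in atTop, μ.real (B n) ≤
      (n : ℝ) ^ (1 / 8 : ℝ) * (2 * Real.exp (1 - (n : ℝ) ^ (1 / 4 : ℝ))) := by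
    filter_upwards [eventually_gt_atTop 0, eventually_pow_le_rpow_of_isLittleO_log hk
      (s := 2 * Fintype.card α) (by linarith) (δ := 1 / 8) (by norm_num)] with n hn hcount
    calc μ.real (B n) ≤ ∑ m ∈ Finset.Ico l (k n), ∑ a : Fin (m + 1) → α,
          2 * Real.exp (1 - (n : ℝ) ^ (1 / 4 : ℝ)) := by
          refine (measureReal_biUnion_finset_le _ _).trans (Finset.sum_le_sum fun m hm => ?_)
          refine (measureReal_iUnion_fintype_le _).trans (Finset.sum_le_sum fun a _ => ?_)
          exact measureReal_abs_sum_excess_ge_le hX hstat hmarkov (Finset.mem_Ico.1 hm).1 a hn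
      _ = (∑ m ∈ Finset.Ico l (k n), (Fintype.card α : ℝ) ^ (m + 1)) *
          (2 * Real.exp (1 - (n : ℝ) ^ (1 / 4 : ℝ))) := by
          rw [Finset.sum_mul]
          simp
      _ ≤ _ := by
          gcongr
          exact (sum_Ico_pow_succ_le hs l (k n)).trans hcount
  have hsum : Summable fun n => μ.real (B n) :=
    summable_of_isBigO_nat summable_rpow_mul_exp_neg_rpow (IsBigO.of_bound 1 (by
      filter_upwards [hBle] with n hn
      rw [Real.norm_of_nonneg measureReal_nonneg, one_mul]
      exact hn.trans (le_abs_self _)))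
  have hfin : ∑' n, μ (B n) ≠ ⊤ := by
    simpa using hsum.tsum_ofReal_ne_top
  filter_upwards [ae_eventually_notMem hfin] with ω hω
  filter_upwards [hω] with n hn m hm a
  by_contra! hge
  exact hn (Set.mem_biUnion hm (Set.mem_iUnion.2 ⟨a, hge⟩))

theorem lemma4 {Ω α : Type*} [MeasurableSpace Ω] (μ : Measure Ω) [IsProbabilityMeasure μ]
    [Fintype α] [DecidableEq α] [MeasurableSpace α] [MeasurableSingletonClass α]
    (X : ℕ → Ω → α) (hX : ∀ i, Measurable (X i))
    (hstat : IsStationaryErgodic μ X) (hmarkov : ∃ l : ℕ, IsMarkovOfOrder μ X l)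
    (k : ℕ → ℕ) (hk : (fun n : ℕ => (k n : ℝ)) =o[atTop] (fun n : ℕ => Real.log (n : ℝ))) :
    ∀ᵐ ω ∂μ, Tendsto
      (fun n : ℕ => tvDistance (empiricalDist n (k n) (fun i => X i ω)) (blockDist μ X (k n)))
      atTop (𝓝 0) := by
  obtain ⟨l, hl⟩ := hmarkov
  have : Nonempty Ω := μ.nonempty_of_neZero
  have : Nonempty α := ‹Nonempty Ω›.map (X 0)
  have hs : (1 : ℝ) ≤ Fintype.card α := by exact_mod_cast Fintype.card_pos
  have hcyc : Tendsto (fun n : ℕ => 2 * (k n : ℝ) / n) atTop (𝓝 0) := by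
    have := ((hk.trans (Real.isLittleO_log_id_atTop.comp_tendsto
      tendsto_natCast_atTop_atTop)).tendsto_div_nhds_zero).const_mul 2
    simpa [mul_div_assoc] using this
  have hmart : Tendsto (fun n : ℕ => (n : ℝ) ^ (-(1 / 8) : ℝ)) atTop (𝓝 0) :=
    (tendsto_rpow_neg_atTop (by norm_num)).comp tendsto_natCast_atTop_atTop
  have hfix : ∀ᵐ ω ∂μ, ∀ i, ∀ a : Fin i → α,
      Tendsto (fun n => blockFreq n i (fun j => X j ω) a) atTop (𝓝 (blockDist μ X i a)) :=
    ae_all_iff.2 fun i => ae_all_iff.2 fun a => ae_tendsto_blockFreq hX hstat i a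
  filter_upwards [hfix, ae_eventually_abs_sum_excess_lt hX hstat hl hk] with ω hω hdev
  have hshort : Tendsto (fun n => ∑ i ∈ Finset.range (l + 1), ∑ b,
      |blockFreq n i (fun j => X j ω) b - blockDist μ X i b|) atTop (𝓝 0) := by
    have h := tendsto_finsetSum (Finset.range (l + 1)) fun i _ =>
      tendsto_finsetSum Finset.univ fun b _ => ((hω i b).sub_const (blockDist μ X i b)).abs
    simpa using h
  have hlim := ((hcyc.add hshort).add hmart).const_mul (1 / 2)
  simp only [add_zero, mul_zero] at hlim
  refine tendsto_of_tendsto_of_tendsto_of_le_of_le' tendsto_const_nhds hlim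
    (Eventually.of_forall fun n => by unfold tvDistance; positivity) ?_
  filter_upwards [hdev, eventually_gt_atTop 0, eventually_pow_le_rpow_of_isLittleO_log hk
      (s := 2 * Fintype.card α) (by linarith) (δ := 1 / 8) (by norm_num)] with n hn hn0 hcount
  have hn0' : (0 : ℝ) < n := by exact_mod_cast hn0
  have hdev' : ∑ m ∈ Finset.Ico l (k n),
      (∑ a, |∑ j ∈ Finset.range n, excess μ X m a j (fun i => X i ω)|) / n ≤
      (n : ℝ) ^ (-(1 / 8) : ℝ) := by
    calc _ ≤ ∑ m ∈ Finset.Ico l (k n), (∑ a : Fin (m + 1) → α, (n : ℝ) ^ (3 / 4 : ℝ)) / n := by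
          refine Finset.sum_le_sum fun m hm => ?_
          gcongr with a
          exact (hn m hm a).le
      _ = (∑ m ∈ Finset.Ico l (k n), (Fintype.card α : ℝ) ^ (m + 1)) *
          ((n : ℝ) ^ (3 / 4 : ℝ) / n) := by
          rw [Finset.sum_mul]
          simp [mul_div_assoc]
      _ ≤ (n : ℝ) ^ (1 / 8 : ℝ) * ((n : ℝ) ^ (3 / 4 : ℝ) / n) := by
          gcongr
          exact (sum_Ico_pow_succ_le hs l (k n)).trans hcount
      _ = _ := by
          rw [← Real.rpow_sub_one hn0'.ne', ← Real.rpow_add hn0']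
          norm_num
  have htri : ∑ a, |empiricalDist n (k n) (fun i => X i ω) a - blockDist μ X (k n) a| ≤
      ∑ a, |empiricalDist n (k n) (fun i => X i ω) a - blockFreq n (k n) (fun i => X i ω) a| +
      ∑ a, |blockFreq n (k n) (fun i => X i ω) a - blockDist μ X (k n) a| := by
    rw [← Finset.sum_add_distrib]
    exact Finset.sum_le_sum fun a _ => abs_sub_le _ _ _
  have h1 := sum_abs_empiricalDist_sub_blockFreq_le n (k n) fun i => X i ω
  have h2 := sum_abs_blockFreq_sub_le μ hX n l (k n) fun i => X i ω
  unfold tvDistance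
  gcongr
  linarith
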